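/- Let $X\subset\mathbb R^n$ be nonempty, closed and convex, and let $\mathcal A\subset\mathbb R^n$ be nonempty and finite, such that the functions $\mathrm e^{\alpha}\colon x\mapsto\exp(\alpha^Tx)$, $\alpha\in\mathcal A$, are linearly independent on $X$. Signomials $\sum_{\alpha\in\mathcal A}c_\alpha \mathrm e^\alpha$ are identified with their coefficient vectors $c\in\mathbb R^{\mathcal A}$. Write $\sigma_X(y)=\sup_{x\in X}y^Tx\in(-\infty,\infty]$, $\mathcal A\nu=\sum_{\alpha}\nu_\alpha\alpha$ for $\nu\in\mathbb R^{\mathcal A}$, and, for $\beta\in\mathcal A$, $$N_\beta=\{\nu\in\mathbb R^{\mathcal A}:\ \nu_\alpha\ge 0\ \text{for all }\alpha\neq\beta,\ \textstyle\sum_\alpha\nu_\alpha=0\},$$ $$C_X(\mathcal A,\beta)=\{c\in\mathbb R^{\mathcal A}:\ \textstyle\sum_\alpha c_\alpha \mathrm e^{\alpha}\ge 0\ \text{on }X,\ c_\alpha\ge0\ \text{for all }\alpha\ne\beta\},\qquad C_X(\mathcal A)=\sum_{\beta\in\mathcal A}C_X(\mathcal A,\beta)\ \text{(Minkowski sum)}.$$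 A vector $\nu\in N_\beta$ is an *$X$-circuit* if $\nu\ne0$, $\sigma_X(-\mathcal A\nu)<\infty$, and $\nu$ cannot be written as $\theta\nu^{(1)}+(1-\theta)\nu^{(2)}$ with $0<\theta<1$ and non-proportional $\nu^{(1)},\nu^{(2)}\in N_\beta$ such that $\tilde\nu\mapsto\sigma_X(-\mathcal A\tilde\nu)$ is (finite and) linear on the segment $[\nu^{(1)},\nu^{(2)}]$. Let $\Lambda_X(\mathcal A)$ be the set of all normalized $X$-circuits, that is, of all $X$-circuits $\lambda\in N_\beta$ with $\lambda_\beta=-1$, for $\beta\in\mathcal A$. For such $\lambda$ put $\phi_\lambda=(\lambda,\sigma_X(-\mathcal A\lambda))\in\mathbb R^{\mathcal A}\times\mathbb R$ and $$C_X(\mathcal A,\lambda)=\Big\{c\in\mathbb R^{\mathcal A}:\ \prod_{\alpha:\lambda_\alpha>0}\Big[\frac{c_\alpha}{\lambda_\alpha}\Big]^{\lambda_\alpha}\ge -c_\beta\exp(\sigma_X(-\mathcal A\lambda)),\ c_\alpha\ge0\ \text{for all }\alpha\ne\beta\Big\}.$$ Let $G_X(\mathcal A)$ be the convex cone (with the origin)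 generated by $\{\phi_\lambda:\lambda\in\Lambda_X(\mathcal A)\}\cup\{(0,1)\}$, and let $\Lambda_X^\star(\mathcal A)$, the set of normalized reduced $X$-circuits, consist of those $\lambda\in\Lambda_X(\mathcal A)$ for which $\{t\phi_\lambda:t\ge0\}$ is an extreme ray (one-dimensional face) of $G_X(\mathcal A)$. **Theorem.** If $\Lambda_X(\mathcal A)=\emptyset$, then $C_X(\mathcal A)=\mathbb R^{\mathcal A}_{+}$. Otherwise, $$C_X(\mathcal A)=\operatorname{cl}\Big(\operatorname{conv}\bigcup_{\lambda\in\Lambda_X^\star(\mathcal A)}C_X(\mathcal A,\lambda)\Big).$$ -/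

import Mathlib

noncomputable section

namespace SublinearCircuits

/-- The space `ℝⁿ` with its Euclidean inner product. -/
abbrev E (n : ℕ) : Type := EuclideanSpace ℝ (Fin n)

variable {n : ℕ}

/-- The support function `σ_X(y) = sup { yᵀx : x ∈ X }`, with values in the extended reals. -/
def supportFun (X : Set (E n)) (y : E n) : EReal :=
  ⨆ x ∈ X, ((inner ℝ y x : ℝ) : EReal)

/-- The finite set `A ⊂ ℝⁿ` as the linear operator `ℝ^A → ℝⁿ`, `ν ↦ ∑ α, ν_α α`. -/
def applyA (A : Finset (E n)) (ν : A → ℝ) : E n :=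
  ∑ α : A, ν α • (α : E n)

/-- The augmented support function `ν ↦ σ_X(-Aν)`. -/
def augSupport (A : Finset (E n)) (X : Set (E n)) (ν : A → ℝ) : EReal :=
  supportFun X (-applyA A ν)

/-- The signomial `∑ α, c_α e^α`, where `e^α` is the function `x ↦ exp(αᵀx)`. -/
def signomial (A : Finset (E n)) (c : A → ℝ) (x : E n) : ℝ :=
  ∑ α : A, c α * Real.exp (inner ℝ (α : E n) x)

/-- The `X`-AGE cone `C_X(A, β)`; signomials are identified with their coefficient vectors. -/
def ageCone (A : Finset (E n)) (X : Set (E n)) (β : A) : Set (A → ℝ) :=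
  {c | (∀ x ∈ X, 0 ≤ signomial A c x) ∧ ∀ α, α ≠ β → 0 ≤ c α}

/-- The `X`-SAGE cone `C_X(A)`: the Minkowski sum of the `X`-AGE cones over `β ∈ A`. -/
def sageCone (A : Finset (E n)) (X : Set (E n)) : Set (A → ℝ) :=
  {c | ∃ f : A → (A → ℝ), (∀ β, f β ∈ ageCone A X β) ∧ c = ∑ β : A, f β}

/-- The cone `N_β` of vectors in `ℝ^A` that sum to zero and are nonnegative off `β`. -/
def coneN (A : Finset (E n)) (β : A) : Set (A → ℝ) :=
  {ν | (∀ α, α ≠ β → 0 ≤ ν α) ∧ ∑ α : A, ν α = 0}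

/-- The extended-real-valued function `g` is finite and linear on the segment `[u, v]`. -/
def LinearOnSegment {V : Type*} [AddCommGroup V] [Module ℝ V] (g : V → EReal) (u v : V) : Prop :=
  g u < ⊤ ∧ g v < ⊤ ∧
    ∀ s ∈ Set.Icc (0 : ℝ) 1,
      g (s • u + (1 - s) • v) = (s : EReal) * g u + ((1 - s : ℝ) : EReal) * g v

/-- `ν ∈ N_β` is an `X`-circuit of `A`: it is nonzero, `σ_X(-Aν) < ∞`, and it is not a (proper)
convex combination of two non-proportional vectors of `N_β` between which the augmented support
function is linear. -/
def IsCircuit (A : Finset (E n)) (X : Set (E n)) (β : A) (ν : A → ℝ) : Prop :=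
  ν ∈ coneN A β ∧ ν ≠ 0 ∧ augSupport A X ν < ⊤ ∧
    ¬ ∃ ν₁ ∈ coneN A β, ∃ ν₂ ∈ coneN A β, ∃ θ ∈ Set.Ioo (0 : ℝ) 1,
      LinearIndependent ℝ ![ν₁, ν₂] ∧ ν = θ • ν₁ + (1 - θ) • ν₂ ∧
        LinearOnSegment (augSupport A X) ν₁ ν₂

/-- The set `Λ_X(A)` of normalized `X`-circuits: those whose negative entry is `-1`. -/
def normalizedCircuits (A : Finset (E n)) (X : Set (E n)) : Set (A → ℝ) :=
  {l | ∃ β : A, IsCircuit A X β l ∧ l β = -1}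

/-- The functional form `φ_ν = (ν, σ_X(-Aν)) ∈ ℝ^A × ℝ`, used where `σ_X(-Aν)` is finite. -/
def functionalForm (A : Finset (E n)) (X : Set (E n)) (ν : A → ℝ) : (A → ℝ) × ℝ :=
  (ν, (augSupport A X ν).toReal)

/-- The circuit graph `G_X(A)`: the conic hull (with the origin) of the functional forms of all
normalized `X`-circuits together with `(0, 1)`. -/
def circuitGraph (A : Finset (E n)) (X : Set (E n)) : PointedCone ℝ ((A → ℝ) × ℝ) :=
  PointedCone.hull ℝ (functionalForm A X '' normalizedCircuits A X ∪ {((0 : A → ℝ), (1 : ℝ))})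

/-- `v` is an edge generator of the cone `K`: it is nonzero and `{t v : t ≥ 0}` is a
(one-dimensional) face of `K`. -/
def IsEdgeGenerator {V : Type*} [AddCommGroup V] [Module ℝ V] (K : Set V) (v : V) : Prop :=
  v ≠ 0 ∧ IsExtreme ℝ K {z | ∃ t : ℝ, 0 ≤ t ∧ z = t • v}

/-- The set `Λ*_X(A)` of normalized reduced `X`-circuits: the normalized `X`-circuits whose
functional form generates an extreme ray of the circuit graph. -/
def reducedCircuits (A : Finset (E n)) (X : Set (E n)) : Set (A → ℝ) :=
  {l | l ∈ normalizedCircuits A X ∧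
    IsEdgeGenerator (circuitGraph A X : Set ((A → ℝ) × ℝ)) (functionalForm A X l)}

/-- The `λ`-witnessed AGE cone `C_X(A, λ)` of a vector `λ ∈ N_β` with `λ_β = -1` (the index `β`
is determined by `λ`), as a set of coefficient vectors. -/
def witnessedCone (A : Finset (E n)) (X : Set (E n)) (l : A → ℝ) : Set (A → ℝ) :=
  {c | ∃ β : A, l ∈ coneN A β ∧ l β = -1 ∧ (∀ α, α ≠ β → 0 ≤ c α) ∧
    -c β * Real.exp (augSupport A X l).toReal ≤
      ∏ α : A with 0 < l α, (c α / l α) ^ (l α)}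

end SublinearCircuits

end

/-!
The inclusion of the closed convex hull in the SAGE cone comes from two facts: the weighted
AM-GM inequality puts every witnessed cone into an AGE cone (`witnessedCone_subset_ageCone`), and
the SAGE cone is closed (`isClosed_sageCone`). For the latter, linear independence of the
exponentials and compactness give finitely many points of `X` whose evaluations add up to a
functional that is positive on all nonzero signomials that are nonnegative on `X`
(`exists_positive_multiplier`); a sum of closed cones sharing such a functional is closed.

The other inclusion is proved by duality. Suppose that a functional with positive coefficients
`exp (u α)` is nonnegative on the cones witnessed by the reduced circuits. Testing it on the vector
for which the product inequality is tight (`tightVector`) gives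
`∑ α, l α * u α + σ_X(-A l) ≥ 0` for every reduced circuit `l`, that is, the linear functional
`(ν, s) ↦ ∑ α, ν α * u α + s` is nonnegative on the functional forms of the reduced circuits.
The epigraph of `ν ↦ σ_X(-A ν)` over `N_β` is a closed cone. The same test applied to the functional
from the first paragraph yields a linear functional positive on all these epigraphs, so their sum
over `β` is a closed cone with compact base, and by the Krein-Milman theorem an inequality
on this sum needs to be checked on extreme rays only. An extreme ray of the sum is spanned by
`(0, 1)` or by the functional form of a circuit (`rayGenerator_totalGraph`). In the latter case the
ray is also extreme in the smaller circuit graph, so the circuit is reduced. Hence the inequality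
holds for all `ν ∈ N_β`. A separation argument in `ℝ^A` (`sub_mem_closure`) turns this into
nonnegativity on the AGE cones (`pairing_nonneg_of_mem_ageCone`). Functionals with vanishing
coefficients are handled by a small perturbation, and separating a point from the closed convex
hull concludes.
-/

noncomputable section

namespace SublinearCircuits

open Finset

/-! ### Closed pointed cones with a positive functional -/

section Cones

variable {V : Type*} [NormedAddCommGroup V] [NormedSpace ℝ V]

/-- `p` spans an extreme ray of the cone `K`, phrased through decompositions `p = a + b`. -/
def IsRayGenerator (K : PointedCone ℝ V) (p : V) : Prop :=
  p ∈ K ∧ p ≠ 0 ∧ ∀ a ∈ K, ∀ b ∈ K, a + b = p → ∃ t : ℝ, 0 ≤ t ∧ a = t • p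

/-- A functional that is positive on a closed cone minus the origin dominates a multiple of the
norm on that cone. -/
theorem exists_mul_norm_le [FiniteDimensional ℝ V] (K : PointedCone ℝ V)
    (hK : IsClosed (K : Set V)) (ψ : V →L[ℝ] ℝ) (hψ : ∀ x ∈ K, x ≠ 0 → 0 < ψ x) :
    ∃ δ : ℝ, 0 < δ ∧ ∀ x ∈ K, δ * ‖x‖ ≤ ψ x := by
  have : ProperSpace V := FiniteDimensional.proper ℝ V
  have hc : IsCompact (Metric.sphere (0 : V) 1 ∩ (K : Set V)) :=
    (isCompact_sphere (0 : V) 1).inter_right hK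
  have key : ∃ δ : ℝ, 0 < δ ∧ ∀ x ∈ Metric.sphere (0 : V) 1 ∩ (K : Set V), δ ≤ ψ x := by
    rcases (Metric.sphere (0 : V) 1 ∩ (K : Set V)).eq_empty_or_nonempty with he | hne
    · exact ⟨1, one_pos, by simp [he]⟩
    · obtain ⟨x, hx, hmin⟩ := hc.exists_isMinOn hne ψ.continuous.continuousOn
      refine ⟨ψ x, hψ x hx.2 ?_, fun y hy => hmin hy⟩
      rintro rfl
      simpa using hx.1
  obtain ⟨δ, hδ, h⟩ := key
  refine ⟨δ, hδ, fun x hx => ?_⟩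
  rcases eq_or_ne x 0 with rfl | hx0
  · simp
  have hn : 0 < ‖x‖ := norm_pos_iff.2 hx0
  have := h (‖x‖⁻¹ • x) ⟨by simp [norm_smul, hn.ne'], K.smul_mem (by positivity) hx⟩
  rw [map_smul, smul_eq_mul, inv_mul_eq_div, le_div_iff₀ hn] at this
  exact this

theorem mem_iSup_cone {ι : Type*} [Fintype ι] (C : ι → PointedCone ℝ V) (x : V) :
    x ∈ ⨆ i, C i ↔ ∃ f : ι → V, (∀ i, f i ∈ C i) ∧ x = ∑ i, f i := by
  have h := Submodule.mem_iSup_finset_iff_exists_sum (s := univ) C x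
  simp only [mem_univ, iSup_pos] at h
  rw [h]
  constructor
  · rintro ⟨μ, rfl⟩
    exact ⟨fun i => μ i, fun i => (μ i).2, rfl⟩
  · rintro ⟨f, hf, rfl⟩
    exact ⟨fun i => ⟨f i, hf i⟩, rfl⟩

/-- A finite sum of closed cones is closed if one functional is positive on all of them: then the
summands of a bounded sum stay in a compact set. -/
theorem isClosed_iSup_cone [FiniteDimensional ℝ V] {ι : Type*} [Fintype ι]
    (C : ι → PointedCone ℝ V) (hC : ∀ i, IsClosed (C i : Set V)) (ψ : V →L[ℝ] ℝ)
    (hψ : ∀ i, ∀ x ∈ C i, x ≠ 0 → 0 < ψ x) :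
    IsClosed ((⨆ i, C i : PointedCone ℝ V) : Set V) := by
  have : ProperSpace V := FiniteDimensional.proper ℝ V
  choose δ hδ hδψ using fun i => exists_mul_norm_le (C i) (hC i) ψ (hψ i)
  refine isClosed_of_closure_subset fun x hx => ?_
  have hcomp : IsCompact ((fun f : ι → V => ∑ i, f i) ''
      Set.univ.pi fun i => (C i : Set V) ∩ Metric.closedBall 0 ((ψ x + 1) / δ i)) := by
    refine (isCompact_univ_pi fun i => ?_).image (by fun_prop)
    exact (isCompact_closedBall 0 _).inter_left (hC i)
  have hopen : IsOpen {y : V | ψ y < ψ x + 1} := isOpen_lt ψ.continuous continuous_const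
  have hx' : x ∈ closure ({y : V | ψ y < ψ x + 1} ∩ ((⨆ i, C i : PointedCone ℝ V) : Set V)) :=
    hopen.inter_closure ⟨by simp, hx⟩
  have hsub : {y : V | ψ y < ψ x + 1} ∩ ((⨆ i, C i : PointedCone ℝ V) : Set V) ⊆
      (fun f : ι → V => ∑ i, f i) ''
        Set.univ.pi fun i => (C i : Set V) ∩ Metric.closedBall 0 ((ψ x + 1) / δ i) := by
    rintro y ⟨hy, hyC⟩
    obtain ⟨f, hf, rfl⟩ := (mem_iSup_cone C y).1 hyC
    refine ⟨f, fun i _ => ⟨hf i, ?_⟩, rfl⟩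
    have hnn : ∀ j ∈ univ, 0 ≤ ψ (f j) := fun j _ =>
      (mul_nonneg (hδ j).le (norm_nonneg _)).trans (hδψ j _ (hf j))
    have h1 : ψ (f i) ≤ ∑ j, ψ (f j) := single_le_sum hnn (mem_univ i)
    have h2 : ∑ j, ψ (f j) < ψ x + 1 := by simpa using hy
    rw [mem_closedBall_zero_iff, le_div_iff₀ (hδ i), mul_comm]
    exact (hδψ i _ (hf i)).trans (h1.trans h2.le)
  obtain ⟨f, hf, rfl⟩ := hcomp.isClosed.closure_subset_iff.2 hsub hx'
  exact (mem_iSup_cone C _).2 ⟨f, fun i => (hf i trivial).1, rfl⟩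

theorem pos_of_mem_iSup_cone {ι : Type*} [Fintype ι] (C : ι → PointedCone ℝ V)
    (ψ : V →L[ℝ] ℝ) (hψ : ∀ i, ∀ x ∈ C i, x ≠ 0 → 0 < ψ x) {x : V}
    (hx : x ∈ ⨆ i, C i) (hx0 : x ≠ 0) : 0 < ψ x := by
  obtain ⟨f, hf, rfl⟩ := (mem_iSup_cone C x).1 hx
  obtain ⟨i, -, hi⟩ := exists_ne_zero_of_sum_ne_zero hx0
  rw [map_sum]
  refine sum_pos' (fun j _ => ?_) ⟨i, mem_univ i, hψ i _ (hf i) hi⟩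
  rcases eq_or_ne (f j) 0 with h | h
  · simp [h]
  · exact (hψ j _ (hf j) h).le

/-- A functional that is nonnegative on all extreme rays of a closed cone with compact base is
nonnegative on the cone: apply the Krein-Milman theorem to the base. -/
theorem nonneg_of_nonneg_rayGenerators [FiniteDimensional ℝ V] (K : PointedCone ℝ V)
    (hK : IsClosed (K : Set V)) (ψ : V →L[ℝ] ℝ) (hpos : ∀ x ∈ K, x ≠ 0 → 0 < ψ x)
    (ℓ : V →L[ℝ] ℝ)
    (hℓ : ∀ p, IsRayGenerator K p → 0 ≤ ℓ p) : ∀ x ∈ K, 0 ≤ ℓ x := by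
  have : ProperSpace V := FiniteDimensional.proper ℝ V
  obtain ⟨δ, hδ, hψ⟩ := exists_mul_norm_le K hK ψ hpos
  set B : Set V := (K : Set V) ∩ {x | ψ x = 1}
  have hBcl : IsClosed B := hK.inter (isClosed_eq ψ.continuous continuous_const)
  have hBcomp : IsCompact B := by
    refine Metric.isCompact_of_isClosed_isBounded hBcl
      ((Metric.isBounded_closedBall (x := (0 : V)) (r := 1 / δ)).subset fun x hx => ?_)
    have h := hψ x hx.1
    rw [show ψ x = 1 from hx.2] at h
    rw [mem_closedBall_zero_iff, le_div_iff₀ hδ, mul_comm]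
    exact h
  have hBconv : Convex ℝ B := K.convex.inter (convex_hyperplane ψ.isLinear 1)
  have hnorm : ∀ a ∈ K, a ≠ 0 → (ψ a)⁻¹ • a ∈ B := fun a ha ha0 =>
    ⟨K.smul_mem (inv_nonneg.2 (hpos a ha ha0).le) ha, by
      simp [(hpos a ha ha0).ne']⟩
  have hext : ∀ p ∈ B.extremePoints ℝ, 0 ≤ ℓ p := by
    intro p hp
    have hp1 : ψ p = 1 := hp.1.2
    refine hℓ p ⟨hp.1.1, by rintro rfl; simp at hp1, fun a ha b hb hab => ?_⟩
    rcases eq_or_ne a 0 with rfl | ha0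
    · exact ⟨0, le_rfl, by simp⟩
    rcases eq_or_ne b 0 with rfl | hb0
    · exact ⟨1, zero_le_one, by simpa using hab⟩
    have hpa := hpos a ha ha0
    have hpb := hpos b hb hb0
    have h := hp.2 (hnorm a ha ha0) (hnorm b hb hb0)
      ⟨ψ a, ψ b, hpa, hpb, by rw [← map_add, hab, hp1], by
        simp [smul_smul, hpa.ne', hpb.ne', hab]⟩
    refine ⟨ψ a, hpa.le, ?_⟩
    rw [← h, smul_smul, mul_inv_cancel₀ hpa.ne', one_smul]
  have hB : B ⊆ {x | 0 ≤ ℓ x} := by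
    rw [← closure_convexHull_extremePoints hBcomp hBconv]
    refine closure_minimal (convexHull_min hext ?_) (isClosed_le continuous_const ℓ.continuous)
    exact convex_halfSpace_ge ℓ.isLinear 0
  intro x hx
  rcases eq_or_ne x 0 with rfl | hx0
  · simp
  have h : 0 ≤ ℓ ((ψ x)⁻¹ • x) := hB (hnorm x hx hx0)
  rw [map_smul, smul_eq_mul] at h
  exact nonneg_of_mul_nonneg_right h (inv_pos.2 (hpos x hx hx0))

/-- An extreme ray of a cone `K` is an extreme subset of every smaller cone containing it. -/
theorem IsRayGenerator.isEdgeGenerator {K G : PointedCone ℝ V} {p : V}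
    (hp : IsRayGenerator K p) (hGK : G ≤ K) (hpG : p ∈ G) :
    IsEdgeGenerator (G : Set V) p := by
  refine ⟨hp.2.1, ?_, ?_⟩
  · rintro _ ⟨t, ht, rfl⟩
    exact G.smul_mem ht hpG
  · rintro x hx y hy _ ⟨t, ht, rfl⟩ ⟨a, b, ha, hb, hab, hxy⟩
    have hax : a • x ∈ K := K.smul_mem ha.le (hGK hx)
    have hby : b • y ∈ K := K.smul_mem hb.le (hGK hy)
    -- Adding `p` to both sides avoids a case distinction on whether `t` vanishes.
    have ht1 : 0 < t + 1 := by linarith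
    obtain ⟨r, hr, h⟩ := hp.2.2 ((t + 1)⁻¹ • (a • x)) (K.smul_mem (by positivity) hax)
      ((t + 1)⁻¹ • (b • y + p)) (K.smul_mem (by positivity) (K.add_mem hby hp.1)) (by
        rw [← smul_add, ← add_assoc, hxy, inv_smul_eq_iff₀ ht1.ne']
        module)
    refine ⟨a⁻¹ * ((t + 1) * r), by positivity, ?_⟩
    rw [mul_smul, mul_smul, ← h, smul_inv_smul₀ ht1.ne', inv_smul_smul₀ ha.ne']

theorem IsRayGenerator.smul {K : PointedCone ℝ V} {p : V} (hp : IsRayGenerator K p) {r : ℝ}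
    (hr : 0 < r) : IsRayGenerator K (r • p) := by
  refine ⟨K.smul_mem hr.le hp.1, smul_ne_zero hr.ne' hp.2.1, fun a ha b hb hab => ?_⟩
  obtain ⟨t, ht, h⟩ := hp.2.2 (r⁻¹ • a) (K.smul_mem (by positivity) ha) (r⁻¹ • b)
    (K.smul_mem (by positivity) hb) (by rw [← smul_add, hab, inv_smul_smul₀ hr.ne'])
  refine ⟨t, ht, ?_⟩
  rw [smul_comm, ← h, smul_inv_smul₀ hr.ne']

/-- An extreme ray of a finite sum of cones lies in one of the summands. -/
theorem IsRayGenerator.exists_mem {ι : Type*} [Fintype ι] {C : ι → PointedCone ℝ V} {p : V}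
    (hp : IsRayGenerator (⨆ i, C i) p) : ∃ i, p ∈ C i := by
  classical
  obtain ⟨f, hf, hsum⟩ := (mem_iSup_cone C p).1 hp.1
  obtain ⟨i, -, hi⟩ := exists_ne_zero_of_sum_ne_zero (hsum ▸ hp.2.1)
  have hmem : ∀ j, f j ∈ ⨆ i, C i := fun j => Submodule.mem_iSup_of_mem j (hf j)
  obtain ⟨t, ht, h⟩ := hp.2.2 (f i) (hmem i) (∑ j ∈ univ.erase i, f j)
    (sum_mem fun j _ => hmem j) (by rw [add_sum_erase univ f (mem_univ i), hsum])
  have ht0 : t ≠ 0 := by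
    rintro rfl
    exact hi (by simpa using h)
  refine ⟨i, ?_⟩
  rw [show p = t⁻¹ • f i by rw [h, inv_smul_smul₀ ht0]]
  exact (C i).smul_mem (inv_nonneg.2 ht) (hf i)

end Cones

variable {n : ℕ} {A : Finset (E n)} {X : Set (E n)}

/-! ### The augmented support function and its epigraphs -/

theorem inner_applyA (ν : A → ℝ) (x : E n) :
    inner ℝ (applyA A ν) x = ∑ α : A, ν α * inner ℝ (α : E n) x := by
  simp [applyA, sum_inner, inner_smul_left]

theorem augSupport_le_coe (ν : A → ℝ) (s : ℝ) :
    augSupport A X ν ≤ (s : EReal) ↔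
      ∀ x ∈ X, -∑ α : A, ν α * inner ℝ (α : E n) x ≤ s := by
  simp only [augSupport, supportFun, iSup_le_iff, EReal.coe_le_coe_iff, inner_neg_left,
    inner_applyA]

theorem augSupport_ne_bot (hX : X.Nonempty) (ν : A → ℝ) : augSupport A X ν ≠ ⊥ := by
  obtain ⟨x, hx⟩ := hX
  intro h
  have h1 : ((inner ℝ (-applyA A ν) x : ℝ) : EReal) ≤ augSupport A X ν :=
    le_iSup₂ (f := fun x (_ : x ∈ X) => ((inner ℝ (-applyA A ν) x : ℝ) : EReal)) x hx
  rw [h, le_bot_iff] at h1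
  exact EReal.coe_ne_bot _ h1

theorem coe_toReal_augSupport (hX : X.Nonempty) {ν : A → ℝ} (h : augSupport A X ν < ⊤) :
    ((augSupport A X ν).toReal : EReal) = augSupport A X ν :=
  EReal.coe_toReal h.ne (augSupport_ne_bot hX ν)

/-- The part over `N_β` of the epigraph of the augmented support function. It is written as an
intersection of half-spaces, so that no extended real numbers occur. -/
def epigraphCone (A : Finset (E n)) (X : Set (E n)) (β : A) :
    PointedCone ℝ ((A → ℝ) × ℝ) where
  carrier := {p | p.1 ∈ coneN A β ∧
    ∀ x ∈ X, -∑ α : A, p.1 α * inner ℝ (α : E n) x ≤ p.2}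
  zero_mem' := by simp [coneN]
  add_mem' := by
    rintro p q ⟨⟨hp1, hp2⟩, hp3⟩ ⟨⟨hq1, hq2⟩, hq3⟩
    refine ⟨⟨fun α hα => add_nonneg (hp1 α hα) (hq1 α hα), ?_⟩, fun x hx => ?_⟩
    · simp [sum_add_distrib, hp2, hq2, -univ_eq_attach]
    · have h1 := hp3 x hx
      have h2 := hq3 x hx
      simp only [Prod.fst_add, Prod.snd_add, Pi.add_apply, add_mul, sum_add_distrib]
      linarith
  smul_mem' := by
    rintro ⟨r, hr⟩ p ⟨⟨hp1, hp2⟩, hp3⟩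
    change r • p ∈ {p : (A → ℝ) × ℝ | _}
    refine ⟨⟨fun α hα => mul_nonneg hr (hp1 α hα), ?_⟩, fun x hx => ?_⟩
    · simp [← mul_sum, hp2, -univ_eq_attach]
    · have h1 := mul_le_mul_of_nonneg_left (hp3 x hx) hr
      simpa [mul_assoc, ← mul_sum] using h1

theorem mem_epigraphCone {β : A} {p : (A → ℝ) × ℝ} :
    p ∈ epigraphCone A X β ↔ p.1 ∈ coneN A β ∧
      ∀ x ∈ X, -∑ α : A, p.1 α * inner ℝ (α : E n) x ≤ p.2 := Iff.rfl

theorem mem_epigraphCone_iff_le {β : A} {p : (A → ℝ) × ℝ} :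
    p ∈ epigraphCone A X β ↔ p.1 ∈ coneN A β ∧ augSupport A X p.1 ≤ (p.2 : EReal) := by
  rw [mem_epigraphCone, augSupport_le_coe]

theorem isClosed_epigraphCone (β : A) :
    IsClosed (epigraphCone A X β : Set ((A → ℝ) × ℝ)) := by
  have : (epigraphCone A X β : Set ((A → ℝ) × ℝ)) =
      ({p | ∀ α, α ≠ β → 0 ≤ p.1 α} ∩ {p | ∑ α : A, p.1 α = 0}) ∩
        {p | ∀ x ∈ X, -∑ α : A, p.1 α * inner ℝ (α : E n) x ≤ p.2} := rfl
  rw [this]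
  refine (IsClosed.inter ?_ ?_).inter ?_
  · simp only [Set.ofPred_forall]
    exact isClosed_iInter fun α => isClosed_iInter fun _ =>
      isClosed_le (by fun_prop) (by fun_prop)
  · exact isClosed_eq (by fun_prop) (by fun_prop)
  · simp only [Set.ofPred_forall]
    exact isClosed_iInter fun x => isClosed_iInter fun _ =>
      isClosed_le (by fun_prop) (by fun_prop)

theorem functionalForm_mem_epigraphCone (hX : X.Nonempty) {β : A} {ν : A → ℝ}
    (hν : ν ∈ coneN A β) (h : augSupport A X ν < ⊤) :
    functionalForm A X ν ∈ epigraphCone A X β :=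
  mem_epigraphCone_iff_le.2 ⟨hν, (coe_toReal_augSupport hX h).ge⟩

theorem augSupport_lt_top_of_mem {β : A} {p : (A → ℝ) × ℝ} (hp : p ∈ epigraphCone A X β) :
    augSupport A X p.1 < ⊤ :=
  (mem_epigraphCone_iff_le.1 hp).2.trans_lt (EReal.coe_lt_top _)

theorem toReal_augSupport_le (hX : X.Nonempty) {β : A} {p : (A → ℝ) × ℝ}
    (hp : p ∈ epigraphCone A X β) : (augSupport A X p.1).toReal ≤ p.2 := by
  have h := (mem_epigraphCone_iff_le.1 hp).2
  rwa [← coe_toReal_augSupport hX (augSupport_lt_top_of_mem hp), EReal.coe_le_coe_iff] at h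

/-! ### Vectors in `N_β` -/

theorem neg_of_mem_coneN {β : A} {ν : A → ℝ} (hν : ν ∈ coneN A β) (h0 : ν ≠ 0) : ν β < 0 := by
  by_contra! h
  have hnn : ∀ α, 0 ≤ ν α := fun α => by
    rcases eq_or_ne α β with rfl | hα
    · exact h
    · exact hν.1 α hα
  exact h0 (funext fun α => (sum_eq_zero_iff_of_nonneg fun i _ => hnn i).1 hν.2 α (mem_univ α))

theorem sum_pos_support [DecidableEq A] {β : A} {l : A → ℝ} (hl : l ∈ coneN A β)
    (hβ : l β = -1) (g : A → ℝ) :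
    ∑ α : A with 0 < l α, l α * g α = ∑ α ∈ univ.erase β, l α * g α := by
  refine sum_subset (fun α hα => ?_) fun α hα hα' => ?_
  · have h : 0 < l α := (mem_filter.1 hα).2
    exact mem_erase.2 ⟨by rintro rfl; linarith, mem_univ α⟩
  · have h0 : l α = 0 := le_antisymm (by simpa using hα') (hl.1 α (mem_erase.1 hα).1)
    simp [h0]

theorem sum_erase_eq [DecidableEq A] {β : A} {l : A → ℝ} (hβ : l β = -1) (g : A → ℝ) :
    ∑ α ∈ univ.erase β, l α * g α = ∑ α, l α * g α + g β := by
  rw [← add_sum_erase univ (fun α => l α * g α) (mem_univ β)]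
  simp [hβ]

theorem sum_support_eq {β : A} {l : A → ℝ} (hl : l ∈ coneN A β) (hβ : l β = -1) (g : A → ℝ) :
    ∑ α : A with 0 < l α, l α * g α = ∑ α, l α * g α + g β := by
  classical
  rw [sum_pos_support hl hβ, sum_erase_eq hβ]

theorem sum_support_eq_one {β : A} {l : A → ℝ} (hl : l ∈ coneN A β) (hβ : l β = -1) :
    ∑ α : A with 0 < l α, l α = 1 := by
  simpa [hl.2, -univ_eq_attach] using sum_support_eq hl hβ (fun _ => 1)

/-! ### Witnessed cones -/

/-- The weighted inequality between arithmetic and geometric mean shows that a vector satisfying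
the product inequality has a nonnegative signomial. -/
theorem witnessedCone_subset_ageCone (hX : X.Nonempty) {l : A → ℝ}
    (hfin : augSupport A X l < ⊤) {c : A → ℝ} (hc : c ∈ witnessedCone A X l) :
    ∃ β, c ∈ ageCone A X β := by
  classical
  obtain ⟨β, hl, hβ, hc0, hprod⟩ := hc
  refine ⟨β, fun x hx => ?_, hc0⟩
  set s := (augSupport A X l).toReal
  have hs : -∑ α : A, l α * inner ℝ (α : E n) x ≤ s :=
    (mem_epigraphCone.1 (functionalForm_mem_epigraphCone hX hl hfin)).2 x hx
  have hne : ∀ α ∈ univ.filter (fun α : A => 0 < l α), α ≠ β := by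
    rintro α hα rfl
    have := (mem_filter.1 hα).2
    linarith
  set e : A → ℝ := fun α => Real.exp (inner ℝ (α : E n) x)
  have hsplit : signomial A c x = c β * e β + ∑ α ∈ univ.erase β, c α * e α :=
    (add_sum_erase univ (fun α => c α * e α) (mem_univ β)).symm
  have hle : ∑ α : A with 0 < l α, c α * e α ≤ ∑ α ∈ univ.erase β, c α * e α := by
    refine sum_le_sum_of_subset_of_nonneg
      (fun α hα => mem_erase.2 ⟨hne α hα, mem_univ α⟩) fun α hα _ => ?_
    exact mul_nonneg (hc0 α (mem_erase.1 hα).1) (Real.exp_pos _).le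
  have hamgm := Real.geom_mean_le_arith_mean_weighted (univ.filter fun α : A => 0 < l α) l
    (fun α => c α / l α * e α) (fun α hα => (mem_filter.1 hα).2.le) (sum_support_eq_one hl hβ)
    (fun α hα => mul_nonneg (div_nonneg (hc0 α (hne α hα)) (mem_filter.1 hα).2.le)
      (Real.exp_pos _).le)
  have harith : ∑ α : A with 0 < l α, l α * (c α / l α * e α) =
      ∑ α : A with 0 < l α, c α * e α := by
    refine sum_congr rfl fun α hα => ?_
    have : l α ≠ 0 := (mem_filter.1 hα).2.ne'
    field_simp
  have hgeom : ∏ α : A with 0 < l α, (c α / l α * e α) ^ l α =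
      (∏ α : A with 0 < l α, (c α / l α) ^ l α) *
        Real.exp (∑ α, l α * inner ℝ (α : E n) x + inner ℝ (β : E n) x) := by
    rw [← sum_support_eq hl hβ, Real.exp_sum, ← prod_mul_distrib]
    refine prod_congr rfl fun α hα => ?_
    rw [Real.mul_rpow (div_nonneg (hc0 α (hne α hα)) (mem_filter.1 hα).2.le)
      (Real.exp_pos _).le, ← Real.exp_mul, mul_comm (l α)]
  rw [harith, hgeom] at hamgm
  rw [hsplit]
  rcases le_or_gt 0 (c β) with hcβ | hcβ
  · have : 0 ≤ ∑ α ∈ univ.erase β, c α * e α :=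
      sum_nonneg fun α hα => mul_nonneg (hc0 α (mem_erase.1 hα).1) (Real.exp_pos _).le
    have := mul_nonneg hcβ (Real.exp_pos (inner ℝ (β : E n) x)).le
    positivity
  · have h1 : -c β * e β ≤ -c β * Real.exp s *
        Real.exp (∑ α, l α * inner ℝ (α : E n) x + inner ℝ (β : E n) x) := by
      rw [mul_assoc, ← Real.exp_add]
      refine mul_le_mul_of_nonneg_left (Real.exp_le_exp.2 ?_) (by linarith)
      linarith
    have h2 := mul_le_mul_of_nonneg_right hprod
      (Real.exp_pos (∑ α, l α * inner ℝ (α : E n) x + inner ℝ (β : E n) x)).le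
    linarith

theorem mem_witnessedCone_of_nonneg {β : A} {l : A → ℝ} (hl : l ∈ coneN A β) (hβ : l β = -1)
    {c : A → ℝ} (hc : ∀ α, 0 ≤ c α) : c ∈ witnessedCone A X l := by
  refine ⟨β, hl, hβ, fun α _ => hc α, ?_⟩
  have h1 : -c β * Real.exp (augSupport A X l).toReal ≤ 0 :=
    mul_nonpos_of_nonpos_of_nonneg (by linarith [hc β]) (Real.exp_pos _).le
  exact h1.trans (prod_nonneg fun α hα =>
    Real.rpow_nonneg (div_nonneg (hc α) (mem_filter.1 hα).2.le) _)

theorem smul_mem_witnessedCone {l c : A → ℝ} (hc : c ∈ witnessedCone A X l) {t : ℝ}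
    (ht : 0 < t) : t • c ∈ witnessedCone A X l := by
  obtain ⟨β, hl, hβ, hc0, hprod⟩ := hc
  refine ⟨β, hl, hβ, fun α hα => mul_nonneg ht.le (hc0 α hα), ?_⟩
  have h : ∏ α : A with 0 < l α, ((t • c) α / l α) ^ l α =
      t * ∏ α : A with 0 < l α, (c α / l α) ^ l α := by
    have h1 : t = ∏ α : A with 0 < l α, t ^ l α := by
      rw [← Real.rpow_sum_of_pos ht, sum_support_eq_one hl hβ, Real.rpow_one]
    conv_rhs => rw [h1, ← prod_mul_distrib]
    refine prod_congr rfl fun α hα => ?_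
    have hpos : 0 < l α := (mem_filter.1 hα).2
    have hαβ : α ≠ β := by
      rintro rfl
      linarith
    rw [← Real.mul_rpow ht.le (div_nonneg (hc0 α hαβ) hpos.le)]
    simp [mul_div_assoc]
  rw [h]
  have := mul_le_mul_of_nonneg_left hprod ht.le
  simp only [Pi.smul_apply, smul_eq_mul]
  linarith

/-- The vector in the `l`-witnessed AGE cone for which the product inequality is an equality and
whose positive coefficients are tuned to the multiplier `exp u`. -/
def tightVector (A : Finset (E n)) (X : Set (E n)) (u l : A → ℝ) (α : A) : ℝ :=
  if 0 ≤ l α then l α * Real.exp (-u α)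
  else -Real.exp (-((∑ γ, l γ * u γ) + u α + (augSupport A X l).toReal))

theorem tightVector_apply_of_ne {β : A} {l : A → ℝ} (hl : l ∈ coneN A β) (u : A → ℝ) {α : A}
    (hα : α ≠ β) : tightVector A X u l α = l α * Real.exp (-u α) :=
  if_pos (hl.1 α hα)

theorem tightVector_apply_self {β : A} {l : A → ℝ} (hβ : l β = -1) (u : A → ℝ) :
    tightVector A X u l β =
      -Real.exp (-((∑ γ, l γ * u γ) + u β + (augSupport A X l).toReal)) :=
  if_neg (by rw [hβ]; norm_num)

theorem tightVector_mem_witnessedCone {β : A} {l : A → ℝ} (hl : l ∈ coneN A β) (hβ : l β = -1)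
    (u : A → ℝ) : tightVector A X u l ∈ witnessedCone A X l := by
  refine ⟨β, hl, hβ, fun α hα => ?_, ?_⟩
  · rw [tightVector_apply_of_ne hl u hα]
    exact mul_nonneg (hl.1 α hα) (Real.exp_pos _).le
  · have h : ∏ α : A with 0 < l α, (tightVector A X u l α / l α) ^ l α =
        Real.exp (-((∑ γ, l γ * u γ) + u β)) := by
      rw [← sum_support_eq hl hβ u, ← sum_neg_distrib, Real.exp_sum]
      refine prod_congr rfl fun α hα => ?_
      have hpos : 0 < l α := (mem_filter.1 hα).2
      rw [tightVector, if_pos hpos.le, mul_div_cancel_left₀ _ hpos.ne', ← Real.exp_mul]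
      ring_nf
    rw [h, tightVector_apply_self hβ, neg_neg, ← Real.exp_add]
    exact (congrArg Real.exp (by ring)).le

theorem exp_pairing_tightVector {β : A} {l : A → ℝ} (hl : l ∈ coneN A β) (hβ : l β = -1)
    (u : A → ℝ) : ∑ α, Real.exp (u α) * tightVector A X u l α =
      1 - Real.exp (-((∑ α, l α * u α) + (augSupport A X l).toReal)) := by
  classical
  rw [← add_sum_erase univ _ (mem_univ β), tightVector_apply_self hβ]
  have h : ∑ α ∈ univ.erase β, Real.exp (u α) * tightVector A X u l α = 1 := by
    rw [← sum_support_eq_one hl hβ]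
    have := sum_pos_support hl hβ (fun _ => 1)
    simp only [mul_one] at this
    rw [this]
    refine sum_congr rfl fun α hα => ?_
    rw [tightVector_apply_of_ne hl u (mem_erase.1 hα).1, mul_left_comm, ← Real.exp_add]
    simp
  rw [h, mul_neg, ← Real.exp_add, neg_add_eq_sub]
  congr 2
  ring

/-! ### A strictly positive multiplier -/

theorem eq_zero_of_signomial_eq_zero
    (hlin : LinearIndependent ℝ
      (fun (α : A) (x : X) => Real.exp (inner ℝ (α : E n) (x : E n))))
    {c : A → ℝ} (hc : ∀ x ∈ X, signomial A c x = 0) : c = 0 := by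
  refine funext (Fintype.linearIndependent_iff.1 hlin c (funext fun x => ?_))
  simpa [signomial] using hc x x.2

/-- Coefficient vectors of signomials that are nonnegative on `X`. -/
def nonnegCone (A : Finset (E n)) (X : Set (E n)) : PointedCone ℝ (A → ℝ) where
  carrier := {c | ∀ x ∈ X, 0 ≤ signomial A c x}
  zero_mem' := by simp [signomial]
  add_mem' := by
    intro c d hc hd x hx
    have := add_nonneg (hc x hx) (hd x hx)
    simpa [signomial, add_mul, sum_add_distrib] using this
  smul_mem' := by
    rintro ⟨r, hr⟩ c hc x hx
    have := mul_nonneg hr (hc x hx)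
    change 0 ≤ signomial A (r • c) x
    simpa [signomial, mul_assoc, ← mul_sum] using this

theorem continuous_signomial (x : E n) : Continuous fun c : A → ℝ => signomial A c x := by
  unfold signomial
  fun_prop

theorem isClosed_nonnegCone : IsClosed (nonnegCone A X : Set (A → ℝ)) := by
  have : (nonnegCone A X : Set (A → ℝ)) = {c | ∀ x ∈ X, 0 ≤ signomial A c x} := rfl
  rw [this]
  simp only [Set.ofPred_forall]
  exact isClosed_iInter fun x => isClosed_iInter fun _ =>
    isClosed_le continuous_const (continuous_signomial x)

/-- The functional `c ↦ ∑ α, v α * c α`. -/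
def pairing (v : A → ℝ) : (A → ℝ) →L[ℝ] ℝ :=
  ∑ α, v α • ContinuousLinearMap.proj α

@[simp]
theorem pairing_apply (v c : A → ℝ) : pairing v c = ∑ α, v α * c α := by
  simp [pairing]

/-- Summing the exponential functions over finitely many points of `X` gives a multiplier that
is positive on nonzero nonnegative signomials: by compactness, finitely many points suffice to
detect every such signomial. -/
theorem exists_positive_multiplier (hX : X.Nonempty)
    (hlin : LinearIndependent ℝ
      (fun (α : A) (x : X) => Real.exp (inner ℝ (α : E n) (x : E n)))) :
    ∃ u : A → ℝ, ∀ c ∈ nonnegCone A X, c ≠ 0 → 0 < pairing (fun α => Real.exp (u α)) c := by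
  classical
  have hcomp : IsCompact (Metric.sphere (0 : A → ℝ) 1 ∩ (nonnegCone A X : Set (A → ℝ))) :=
    (isCompact_sphere (0 : A → ℝ) 1).inter_right isClosed_nonnegCone
  obtain ⟨t, ht⟩ := hcomp.elim_finite_subcover
    (fun x : X => {c : A → ℝ | 0 < signomial A c x})
    (fun x => isOpen_lt continuous_const (continuous_signomial _)) (by
      rintro c ⟨hc1, hc⟩
      by_contra hcon
      simp only [Set.mem_iUnion, Set.mem_ofPred_eq, not_exists, not_lt] at hcon
      have h0 : c = 0 := eq_zero_of_signomial_eq_zero hlin fun x hx =>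
        le_antisymm (hcon ⟨x, hx⟩) (hc x hx)
      simp [h0] at hc1)
  obtain ⟨x₀, hx₀⟩ := hX
  -- The extra point keeps the sum of exponentials positive when the subcover is empty.
  set F : Finset X := insert ⟨x₀, hx₀⟩ t
  have hpos : ∀ α : A, 0 < ∑ x ∈ F, Real.exp (inner ℝ (α : E n) (x : E n)) := fun α =>
    sum_pos (fun _ _ => Real.exp_pos _) (insert_nonempty _ _)
  refine ⟨fun α => Real.log (∑ x ∈ F, Real.exp (inner ℝ (α : E n) (x : E n))),
    fun c hc hc0 => ?_⟩
  have hpair : pairing (fun α : A => Real.exp (Real.log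
      (∑ x ∈ F, Real.exp (inner ℝ (α : E n) (x : E n))))) c = ∑ x ∈ F, signomial A c x := by
    simp only [pairing_apply, Real.exp_log (hpos _), signomial, sum_mul]
    rw [sum_comm]
    simp only [mul_comm]
  rw [hpair]
  have hn : 0 < ‖c‖ := norm_pos_iff.2 hc0
  have hmem : ‖c‖⁻¹ • c ∈ Metric.sphere (0 : A → ℝ) 1 ∩ (nonnegCone A X : Set (A → ℝ)) :=
    ⟨by simp [norm_smul, hn.ne'], (nonnegCone A X).smul_mem (by positivity) hc⟩
  obtain ⟨x, hxt, hx⟩ := Set.mem_iUnion₂.1 (ht hmem)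
  refine sum_pos' (fun y _ => hc y y.2) ⟨x, mem_insert_of_mem hxt, ?_⟩
  have h : signomial A (‖c‖⁻¹ • c) x = ‖c‖⁻¹ * signomial A c x := by
    simp [signomial, mul_assoc, ← mul_sum]
  rw [Set.mem_ofPred_eq, h] at hx
  exact pos_of_mul_pos_right hx (inv_pos.2 hn).le

/-- The functional `(ν, s) ↦ ∑ α, ν α * u α + s`. -/
def graphFunctional (u : A → ℝ) : ((A → ℝ) × ℝ) →L[ℝ] ℝ :=
  (pairing u).comp (ContinuousLinearMap.fst ℝ _ _) + ContinuousLinearMap.snd ℝ _ _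

@[simp]
theorem graphFunctional_apply (u : A → ℝ) (p : (A → ℝ) × ℝ) :
    graphFunctional u p = (∑ α, p.1 α * u α) + p.2 := by
  simp [graphFunctional, mul_comm]

theorem graphFunctional_functionalForm (u l : A → ℝ) :
    graphFunctional u (functionalForm A X l) =
      (∑ α, l α * u α) + (augSupport A X l).toReal := by
  simp [functionalForm]

theorem exists_normalized_multiple {β : A} {p : (A → ℝ) × ℝ} (hp : p ∈ epigraphCone A X β)
    (h0 : p.1 ≠ 0) : ∃ r : ℝ, 0 < r ∧ ∃ q ∈ epigraphCone A X β, q = r • p ∧ q.1 β = -1 := by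
  have hneg : p.1 β < 0 := neg_of_mem_coneN (mem_epigraphCone.1 hp).1 h0
  have hne : p.1 β ≠ 0 := hneg.ne
  have hr : 0 < (-p.1 β)⁻¹ := inv_pos.2 (by linarith)
  refine ⟨(-p.1 β)⁻¹, hr, _, PointedCone.smul_mem _ hr.le hp, rfl, ?_⟩
  rw [Prod.smul_fst, Pi.smul_apply, smul_eq_mul]
  field_simp

theorem sum_mul_add_augSupport_pos (hX : X.Nonempty) {u : A → ℝ}
    (hu : ∀ c ∈ nonnegCone A X, c ≠ 0 → 0 < pairing (fun α => Real.exp (u α)) c) {β : A}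
    {l : A → ℝ} (hl : l ∈ coneN A β) (hβ : l β = -1) (hfin : augSupport A X l < ⊤) :
    0 < (∑ α, l α * u α) + (augSupport A X l).toReal := by
  obtain ⟨β', hage⟩ :=
    witnessedCone_subset_ageCone hX hfin (tightVector_mem_witnessedCone (X := X) hl hβ u)
  have hne : tightVector A X u l ≠ 0 := fun h => by
    have h1 := tightVector_apply_self (X := X) hβ u
    rw [h, Pi.zero_apply, zero_eq_neg] at h1
    exact (Real.exp_pos _).ne' h1
  have hpos := hu _ hage.1 hne
  rwa [pairing_apply, exp_pairing_tightVector hl hβ, sub_pos, Real.exp_lt_one_iff,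
    neg_lt_zero] at hpos

/-- Testing a multiplier on tight vectors shows that its logarithm is positive on the epigraph
of the augmented support function. -/
theorem graphFunctional_pos (hX : X.Nonempty) {u : A → ℝ}
    (hu : ∀ c ∈ nonnegCone A X, c ≠ 0 → 0 < pairing (fun α => Real.exp (u α)) c) {β : A}
    {p : (A → ℝ) × ℝ} (hp : p ∈ epigraphCone A X β) (hp0 : p ≠ 0) :
    0 < graphFunctional u p := by
  obtain ⟨hN, hs⟩ := mem_epigraphCone.1 hp
  rcases eq_or_ne p.1 0 with hν | hν0
  · obtain ⟨x, hx⟩ := hX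
    have h1 : 0 ≤ p.2 := by simpa [hν] using hs x hx
    have h2 : p.2 ≠ 0 := fun h => hp0 (Prod.ext hν h)
    simpa [hν] using lt_of_le_of_ne h1 h2.symm
  obtain ⟨r, hr, q, hq, hqp, hβ⟩ := exists_normalized_multiple hp hν0
  have hpos := sum_mul_add_augSupport_pos hX hu (mem_epigraphCone.1 hq).1 hβ
    (augSupport_lt_top_of_mem hq)
  have hle := toReal_augSupport_le hX hq
  have hscale : r * graphFunctional u p = graphFunctional u q := by
    rw [hqp, map_smul, smul_eq_mul]
  have : 0 < r * graphFunctional u p := by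
    rw [hscale, graphFunctional_apply]
    linarith
  exact pos_of_mul_pos_right this hr.le

/-! ### Extreme rays of the sum of the epigraphs -/

/-- The Minkowski sum of the epigraph cones over all `β`. -/
def totalGraph (A : Finset (E n)) (X : Set (E n)) : PointedCone ℝ ((A → ℝ) × ℝ) :=
  ⨆ β, epigraphCone A X β

theorem mem_totalGraph {β : A} {p : (A → ℝ) × ℝ} (hp : p ∈ epigraphCone A X β) :
    p ∈ totalGraph A X :=
  Submodule.mem_iSup_of_mem β hp

theorem zero_mk_mem_epigraphCone (β : A) {s : ℝ} (hs : 0 ≤ s) :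
    ((0 : A → ℝ), s) ∈ epigraphCone A X β :=
  mem_epigraphCone.2 ⟨by simp [coneN], by simpa using fun _ _ => hs⟩

theorem circuitGraph_le_totalGraph (hA : A.Nonempty) (hX : X.Nonempty) :
    circuitGraph A X ≤ totalGraph A X := by
  refine Submodule.span_le.2 ?_
  rintro p (⟨l, ⟨β, hl, -⟩, rfl⟩ | rfl)
  · exact mem_totalGraph (functionalForm_mem_epigraphCone hX hl.1 hl.2.2.1)
  · obtain ⟨β, hβ⟩ := hA
    exact mem_totalGraph (zero_mk_mem_epigraphCone ⟨β, hβ⟩ zero_le_one)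

/-- An extreme ray lies on the lower boundary of the epigraph. -/
theorem functionalForm_eq_of_isRayGenerator (hX : X.Nonempty) {β : A} {q : (A → ℝ) × ℝ}
    (hq : IsRayGenerator (totalGraph A X) q) (hqβ : q ∈ epigraphCone A X β)
    (hβ : q.1 β = -1) : functionalForm A X q.1 = q := by
  have hle := toReal_augSupport_le hX hqβ
  obtain ⟨t, -, h⟩ := hq.2.2 (functionalForm A X q.1)
    (mem_totalGraph (functionalForm_mem_epigraphCone hX (mem_epigraphCone.1 hqβ).1
      (augSupport_lt_top_of_mem hqβ)))
    (0, q.2 - (augSupport A X q.1).toReal)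
    (mem_totalGraph (zero_mk_mem_epigraphCone β (sub_nonneg.2 hle)))
    (Prod.ext (by simp [functionalForm]) (by simp [functionalForm]))
  have h1 := congrArg (fun p : (A → ℝ) × ℝ => p.1 β) h
  simp only [functionalForm, Prod.smul_fst, Pi.smul_apply, hβ, smul_eq_mul] at h1
  rw [h, show t = 1 by linarith, one_smul]

/-- Linearity on a segment splits a functional form into two points of the cone, so the first
components of an extreme ray are circuits. -/
theorem isCircuit_of_isRayGenerator (hX : X.Nonempty) {β : A} {q : (A → ℝ) × ℝ}
    (hq : IsRayGenerator (totalGraph A X) q) (hqβ : q ∈ epigraphCone A X β)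
    (hβ : q.1 β = -1) : IsCircuit A X β q.1 := by
  have hform := functionalForm_eq_of_isRayGenerator hX hq hqβ hβ
  have hfin := augSupport_lt_top_of_mem hqβ
  refine ⟨(mem_epigraphCone.1 hqβ).1, fun h => by simp [h] at hβ, hfin, ?_⟩
  rintro ⟨ν₁, hν₁, ν₂, hν₂, θ, ⟨hθ0, hθ1⟩, hind, hν, hfin₁, hfin₂, hseg⟩
  have hθ1' : 0 < 1 - θ := sub_pos.2 hθ1
  have h1 : θ • functionalForm A X ν₁ ∈ totalGraph A X :=
    PointedCone.smul_mem _ hθ0.le (mem_totalGraph (functionalForm_mem_epigraphCone hX hν₁ hfin₁))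
  have h2 : (1 - θ) • functionalForm A X ν₂ ∈ totalGraph A X :=
    PointedCone.smul_mem _ hθ1'.le
      (mem_totalGraph (functionalForm_mem_epigraphCone hX hν₂ hfin₂))
  have hσ : (augSupport A X q.1).toReal =
      θ * (augSupport A X ν₁).toReal + (1 - θ) * (augSupport A X ν₂).toReal := by
    have h := hseg θ ⟨hθ0.le, hθ1.le⟩
    rw [← hν, ← coe_toReal_augSupport hX hfin, ← coe_toReal_augSupport hX hfin₁,
      ← coe_toReal_augSupport hX hfin₂] at h
    exact_mod_cast h
  have hsum : θ • functionalForm A X ν₁ + (1 - θ) • functionalForm A X ν₂ = q := by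
    rw [← hform]
    exact Prod.ext hν.symm hσ.symm
  obtain ⟨t, -, ht⟩ := hq.2.2 _ h1 _ h2 hsum
  obtain ⟨r, -, hr⟩ := hq.2.2 _ h2 _ h1 (by rw [add_comm, hsum])
  have ht1 : θ • ν₁ = t • q.1 := congrArg Prod.fst ht
  have hr1 : (1 - θ) • ν₂ = r • q.1 := congrArg Prod.fst hr
  have hzero : (r * θ) • ν₁ + (-(t * (1 - θ))) • ν₂ = 0 := by
    rw [neg_smul, mul_smul, mul_smul, ht1, hr1, smul_comm r t, add_neg_cancel]
  obtain ⟨hr0, ht0⟩ := LinearIndependent.pair_iff.1 hind _ _ hzero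
  have hr0' : r = 0 := (mul_eq_zero.1 hr0).resolve_right hθ0.ne'
  have ht0' : t = 0 := (mul_eq_zero.1 (neg_eq_zero.1 ht0)).resolve_right hθ1'.ne'
  refine hq.2.1 ?_
  rw [← hsum, ht, hr, ht0', hr0', zero_smul, add_zero]

theorem rayGenerator_totalGraph (hA : A.Nonempty) (hX : X.Nonempty) {p : (A → ℝ) × ℝ}
    (hp : IsRayGenerator (totalGraph A X) p) :
    (p.1 = 0 ∧ 0 ≤ p.2) ∨
      ∃ r : ℝ, 0 < r ∧ ∃ l ∈ reducedCircuits A X, functionalForm A X l = r • p := by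
  obtain ⟨β, hpβ⟩ := hp.exists_mem
  rcases eq_or_ne p.1 0 with h0 | h0
  · obtain ⟨x, hx⟩ := hX
    exact .inl ⟨h0, by simpa [h0] using (mem_epigraphCone.1 hpβ).2 x hx⟩
  · obtain ⟨r, hr, q, hqβ, hqp, hβ⟩ := exists_normalized_multiple hpβ h0
    have hq : IsRayGenerator (totalGraph A X) q := hqp ▸ hp.smul hr
    have hform := functionalForm_eq_of_isRayGenerator hX hq hqβ hβ
    have hcirc : q.1 ∈ normalizedCircuits A X := ⟨β, isCircuit_of_isRayGenerator hX hq hqβ hβ, hβ⟩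
    refine .inr ⟨r, hr, q.1, ⟨hcirc, ?_⟩, hform.trans hqp⟩
    rw [hform]
    exact hq.isEdgeGenerator (circuitGraph_le_totalGraph hA hX)
      (hform ▸ PointedCone.subset_hull (.inl (Set.mem_image_of_mem _ hcirc)))

/-- Inequalities for the reduced circuits imply those for all vectors in `N_β`: the reduced
circuits and `(0, 1)` account for all extreme rays. -/
theorem graphFunctional_nonneg_of_reducedCircuits (hA : A.Nonempty) (hX : X.Nonempty)
    (hlin : LinearIndependent ℝ
      (fun (α : A) (x : X) => Real.exp (inner ℝ (α : E n) (x : E n))))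
    {u : A → ℝ}
    (hu : ∀ l ∈ reducedCircuits A X, 0 ≤ (∑ α, l α * u α) + (augSupport A X l).toReal)
    {β : A} {p : (A → ℝ) × ℝ} (hp : p ∈ epigraphCone A X β) : 0 ≤ graphFunctional u p := by
  obtain ⟨u₀, hu₀⟩ := exists_positive_multiplier hX hlin
  have hpos : ∀ β, ∀ q ∈ epigraphCone A X β, q ≠ 0 → 0 < graphFunctional u₀ q :=
    fun β q hq hq0 => graphFunctional_pos hX hu₀ hq hq0
  refine nonneg_of_nonneg_rayGenerators (totalGraph A X)
    (isClosed_iSup_cone _ isClosed_epigraphCone (graphFunctional u₀) hpos) (graphFunctional u₀)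
    (fun q hq hq0 => pos_of_mem_iSup_cone _ (graphFunctional u₀) hpos hq hq0)
    (graphFunctional u) (fun q hq => ?_) p (mem_totalGraph hp)
  rcases rayGenerator_totalGraph hA hX hq with ⟨h1, h2⟩ | ⟨r, hr, l, hl, h⟩
  · simpa [h1] using h2
  · have hul := hu l hl
    rw [← graphFunctional_functionalForm, h, map_smul, smul_eq_mul] at hul
    exact nonneg_of_mul_nonneg_right hul hr

theorem reducedCircuits_nonempty (hA : A.Nonempty) (hX : X.Nonempty)
    (hlin : LinearIndependent ℝ
      (fun (α : A) (x : X) => Real.exp (inner ℝ (α : E n) (x : E n))))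
    (h : (normalizedCircuits A X).Nonempty) : (reducedCircuits A X).Nonempty := by
  by_contra! hempty
  obtain ⟨l, β, hl, hβ⟩ := h
  set σ := (augSupport A X l).toReal
  -- Without reduced circuits every `u` would satisfy the inequality for `l`, but a large negative
  -- multiple of `l` violates it.
  have hnn := graphFunctional_nonneg_of_reducedCircuits hA hX hlin
    (u := fun α => -(|σ| + 1) * l α) (by simp [hempty])
    (functionalForm_mem_epigraphCone hX hl.1 hl.2.2.1)
  rw [graphFunctional_functionalForm] at hnn
  have h1 : 1 ≤ ∑ α, l α * l α := by
    have := single_le_sum (fun α _ => mul_self_nonneg (l α)) (mem_univ β)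
    rw [hβ] at this
    linarith
  have h2 : ∑ α, l α * (-(|σ| + 1) * l α) = -(|σ| + 1) * ∑ α, l α * l α := by
    rw [mul_sum]
    exact sum_congr rfl fun α _ => by ring
  rw [h2] at hnn
  nlinarith [le_abs_self σ, abs_nonneg σ]

/-! ### Duality for the AGE cones -/

/-- If `u` satisfies the inequalities of `N_β`, a separation argument shows that the differences
`u α - u β` are, up to closure, bounded below by `⟪α, x⟫ - ⟪β, x⟫` for a point `x` of `X`. -/
theorem sub_mem_closure (hX : X.Nonempty) (hXconvex : Convex ℝ X) {u : A → ℝ} {β : A}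
    (hu : ∀ p ∈ epigraphCone A X β, 0 ≤ graphFunctional u p) :
    (fun α => u α - u β) ∈ closure {w : A → ℝ | ∃ x ∈ X, ∀ α, α ≠ β →
      inner ℝ (α : E n) x - inner ℝ (β : E n) x ≤ w α} := by
  classical
  set S : Set (A → ℝ) := {w | ∃ x ∈ X, ∀ α, α ≠ β →
      inner ℝ (α : E n) x - inner ℝ (β : E n) x ≤ w α}
  have hS : Convex ℝ S := by
    rintro w ⟨x, hx, hw⟩ z ⟨y, hy, hz⟩ a b ha hb hab
    refine ⟨a • x + b • y, hXconvex hx hy ha hb hab, fun α hα => ?_⟩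
    have h1 := mul_le_mul_of_nonneg_left (hw α hα) ha
    have h2 := mul_le_mul_of_nonneg_left (hz α hα) hb
    simp only [inner_add_right, inner_smul_right, Pi.add_apply, Pi.smul_apply, smul_eq_mul]
    linarith
  by_contra hnot
  obtain ⟨f, s, hf1, hf2⟩ := geometric_hahn_banach_point_closed hS.closure isClosed_closure hnot
  set μ : A → ℝ := fun α => f (Pi.single α 1)
  have hfμ : ∀ w : A → ℝ, f w = ∑ α, μ α * w α := fun w => by
    conv_lhs => rw [pi_eq_sum_univ' w, map_sum]
    simp [μ, mul_comm]
  have hμ : ∀ α, α ≠ β → 0 ≤ μ α := by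
    intro α hα
    obtain ⟨x, hx⟩ := hX
    set b : A → ℝ := fun γ => inner ℝ (γ : E n) x - inner ℝ (β : E n) x
    by_contra! hneg
    have ht : 0 ≤ (f b - s) / (-μ α) :=
      div_nonneg (sub_nonneg.2 (hf2 b (subset_closure ⟨x, hx, fun _ _ => le_rfl⟩)).le)
        (by linarith)
    have h := hf2 (b + ((f b - s) / (-μ α)) • Pi.single α 1) (subset_closure ⟨x, hx, fun γ _ => by
      have : (0 : ℝ) ≤ (Pi.single α 1 : A → ℝ) γ := by
        rw [Pi.single_apply]
        split_ifs <;> norm_num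
      have := mul_nonneg ht this
      simpa [b] using this⟩)
    rw [map_add, map_smul, smul_eq_mul] at h
    change s < f b + (f b - s) / (-μ α) * μ α at h
    have hne : μ α ≠ 0 := hneg.ne
    rw [div_neg, neg_mul, div_mul_cancel₀ _ hne] at h
    linarith
  set ν : A → ℝ := fun α => μ α - (∑ γ, μ γ) * (Pi.single β 1 : A → ℝ) α
  have hν : ∀ g : A → ℝ, ∑ α, ν α * g α = ∑ α, μ α * (g α - g β) := fun g => by
    simp only [ν, sub_mul, mul_sub, sum_sub_distrib, mul_assoc, ← mul_sum, ← sum_mul]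
    simp [Pi.single_apply, -univ_eq_attach]
  have hmem : (ν, -s) ∈ epigraphCone A X β := by
    refine mem_epigraphCone.2 ⟨⟨fun α hα => ?_, ?_⟩, fun x hx => ?_⟩
    · simpa [ν, hα] using hμ α hα
    · simpa [-univ_eq_attach] using hν fun _ => 1
    · rw [hν fun α : A => inner ℝ (α : E n) x,
        ← hfμ fun α : A => inner ℝ (α : E n) x - inner ℝ (β : E n) x]
      exact neg_le_neg (hf2 _ (subset_closure ⟨x, hx, fun _ _ => le_rfl⟩)).le
  have h := hu _ hmem
  rw [graphFunctional_apply, hν u, ← hfμ fun α => u α - u β] at h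
  linarith

/-- Weak duality on the AGE cone extends to the closure obtained in `sub_mem_closure`. -/
theorem pairing_nonneg_of_mem_ageCone (hX : X.Nonempty) (hXconvex : Convex ℝ X) {u : A → ℝ}
    {β : A} (hu : ∀ p ∈ epigraphCone A X β, 0 ≤ graphFunctional u p) {c : A → ℝ}
    (hc : c ∈ ageCone A X β) : 0 ≤ pairing (fun α => Real.exp (u α)) c := by
  classical
  have hclosed : IsClosed {w : A → ℝ | 0 ≤ c β + ∑ α ∈ univ.erase β, c α * Real.exp (w α)} :=
    isClosed_le continuous_const (by fun_prop)
  have hsub := closure_minimal (fun w => ?_) hclosed (sub_mem_closure hX hXconvex hu)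
  · have h : pairing (fun α => Real.exp (u α)) c = Real.exp (u β) *
        (c β + ∑ α ∈ univ.erase β, c α * Real.exp (u α - u β)) := by
      rw [pairing_apply, ← add_sum_erase univ _ (mem_univ β), mul_add, mul_sum]
      congr 1
      refine sum_congr rfl fun α _ => ?_
      rw [mul_left_comm, ← Real.exp_add, add_sub_cancel, mul_comm]
    rw [h]
    exact mul_nonneg (Real.exp_pos _).le hsub
  · rintro ⟨x, hx, hw⟩
    have h1 : ∑ α ∈ univ.erase β,
        c α * Real.exp (inner ℝ (α : E n) x - inner ℝ (β : E n) x) ≤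
        ∑ α ∈ univ.erase β, c α * Real.exp (w α) := by
      refine sum_le_sum fun α hα => ?_
      have hα' := (mem_erase.1 hα).1
      exact mul_le_mul_of_nonneg_left (Real.exp_le_exp.2 (hw α hα')) (hc.2 α hα')
    have h2 : signomial A c x = Real.exp (inner ℝ (β : E n) x) * (c β + ∑ α ∈ univ.erase β,
        c α * Real.exp (inner ℝ (α : E n) x - inner ℝ (β : E n) x)) := by
      rw [signomial, ← add_sum_erase univ _ (mem_univ β), mul_add, mul_sum, mul_comm]
      congr 1
      refine sum_congr rfl fun α _ => ?_
      rw [mul_left_comm, ← Real.exp_add, add_sub_cancel]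
    have h3 := hc.1 x hx
    rw [h2] at h3
    have h4 := nonneg_of_mul_nonneg_right h3 (Real.exp_pos _)
    exact h4.trans (by linarith)

/-! ### The SAGE cone and its dual description -/

/-- The `X`-AGE cone as a pointed cone. -/
def agePointedCone (A : Finset (E n)) (X : Set (E n)) (β : A) : PointedCone ℝ (A → ℝ) where
  carrier := ageCone A X β
  zero_mem' := by simp [ageCone, signomial]
  add_mem' := fun {_ _} hc hd => ⟨(nonnegCone A X).add_mem hc.1 hd.1,
    fun α hα => add_nonneg (hc.2 α hα) (hd.2 α hα)⟩
  smul_mem' := fun r _ hc => ⟨(nonnegCone A X).smul_mem r.2 hc.1,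
    fun α hα => mul_nonneg r.2 (hc.2 α hα)⟩

theorem sageCone_eq_iSup :
    sageCone A X = ((⨆ β, agePointedCone A X β : PointedCone ℝ (A → ℝ)) : Set (A → ℝ)) :=
  Set.ext fun c => (mem_iSup_cone (agePointedCone A X) c).symm

theorem isClosed_agePointedCone (β : A) :
    IsClosed (agePointedCone A X β : Set (A → ℝ)) := by
  have : (agePointedCone A X β : Set (A → ℝ)) =
      (nonnegCone A X : Set (A → ℝ)) ∩ {c | ∀ α, α ≠ β → 0 ≤ c α} := rfl
  rw [this]
  refine isClosed_nonnegCone.inter ?_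
  simp only [Set.ofPred_forall]
  exact isClosed_iInter fun α => isClosed_iInter fun _ =>
    isClosed_le continuous_const (continuous_apply α)

theorem isClosed_sageCone (hX : X.Nonempty)
    (hlin : LinearIndependent ℝ
      (fun (α : A) (x : X) => Real.exp (inner ℝ (α : E n) (x : E n)))) :
    IsClosed (sageCone A X) := by
  obtain ⟨u, hu⟩ := exists_positive_multiplier hX hlin
  rw [sageCone_eq_iSup]
  exact isClosed_iSup_cone _ isClosed_agePointedCone _ fun β c hc => hu c hc.1

theorem mem_sageCone_of_mem_ageCone {β : A} {c : A → ℝ} (hc : c ∈ ageCone A X β) :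
    c ∈ sageCone A X := by
  rw [sageCone_eq_iSup]
  exact Submodule.mem_iSup_of_mem β hc

/-- A functional that is nonnegative on the orthant and on the cones witnessed by the reduced
circuits is nonnegative on the SAGE cone. A small multiple of a positive multiplier is added to
make all its coefficients positive, so that logarithms can be taken. -/
theorem nonneg_on_sageCone (hA : A.Nonempty) (hX : X.Nonempty) (hXconvex : Convex ℝ X)
    (hlin : LinearIndependent ℝ
      (fun (α : A) (x : X) => Real.exp (inner ℝ (α : E n) (x : E n))))
    (f : (A → ℝ) →L[ℝ] ℝ) (hf : ∀ c : A → ℝ, (∀ α, 0 ≤ c α) → 0 ≤ f c)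
    (hfw : ∀ l ∈ reducedCircuits A X, ∀ c ∈ witnessedCone A X l, 0 ≤ f c)
    {c : A → ℝ} (hc : c ∈ sageCone A X) : 0 ≤ f c := by
  classical
  obtain ⟨u₀, hu₀⟩ := exists_positive_multiplier hX hlin
  set g : (A → ℝ) →L[ℝ] ℝ := pairing fun α => Real.exp (u₀ α)
  have hg : ∀ d ∈ nonnegCone A X, 0 ≤ g d := fun d hd => by
    rcases eq_or_ne d 0 with rfl | hd0
    · simp
    · exact (hu₀ d hd hd0).le
  have hmain : ∀ ε : ℝ, 0 < ε → 0 ≤ f c + ε * g c := by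
    intro ε hε
    have hv : ∀ α : A, 0 < f (Pi.single α 1) + ε * Real.exp (u₀ α) := fun α =>
      add_pos_of_nonneg_of_pos (hf _ fun γ => by
        rw [Pi.single_apply]
        split_ifs <;> norm_num) (mul_pos hε (Real.exp_pos _))
    set u : A → ℝ := fun α => Real.log (f (Pi.single α 1) + ε * Real.exp (u₀ α))
    have hu : ∀ d, pairing (fun α => Real.exp (u α)) d = f d + ε * g d := fun d => by
      have hfd : f d = ∑ α, f (Pi.single α 1) * d α := by
        conv_lhs => rw [pi_eq_sum_univ' d, map_sum]
        simp [mul_comm]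
      simp only [u, g, pairing_apply, Real.exp_log (hv _), hfd, add_mul, sum_add_distrib,
        mul_sum, mul_assoc]
    have hred : ∀ l ∈ reducedCircuits A X,
        0 ≤ (∑ α, l α * u α) + (augSupport A X l).toReal := by
      intro l hl
      obtain ⟨β, hcirc, hβ⟩ := hl.1
      have hw := tightVector_mem_witnessedCone (X := X) hcirc.1 hβ u
      obtain ⟨β', hage⟩ := witnessedCone_subset_ageCone hX hcirc.2.2.1 hw
      have h := add_nonneg (hfw l hl _ hw) (mul_nonneg hε.le (hg _ hage.1))
      rw [← hu, pairing_apply, exp_pairing_tightVector hcirc.1 hβ, sub_nonneg,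
        Real.exp_le_one_iff, neg_nonpos] at h
      exact h
    obtain ⟨F, hF, rfl⟩ := hc
    rw [← hu, map_sum]
    exact sum_nonneg fun β _ => pairing_nonneg_of_mem_ageCone hX hXconvex
      (fun p hp => graphFunctional_nonneg_of_reducedCircuits hA hX hlin hred hp) (hF β)
  have hlim : Filter.Tendsto (fun ε : ℝ => f c + ε * g c) (nhdsWithin 0 (Set.Ioi 0))
      (nhds (f c + 0 * g c)) :=
    ((by fun_prop : Continuous fun ε : ℝ => f c + ε * g c).tendsto 0).mono_left
      nhdsWithin_le_nhds
  rw [zero_mul, add_zero] at hlim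
  exact ge_of_tendsto hlim (Filter.eventually_of_mem self_mem_nhdsWithin hmain)

theorem sageCone_eq_nonneg (hA : A.Nonempty) (hX : X.Nonempty) (hXconvex : Convex ℝ X)
    (hlin : LinearIndependent ℝ
      (fun (α : A) (x : X) => Real.exp (inner ℝ (α : E n) (x : E n))))
    (h : normalizedCircuits A X = ∅) : sageCone A X = {c | ∀ α, 0 ≤ c α} := by
  refine Set.Subset.antisymm (fun c hc γ => ?_) fun c hc => ?_
  · have hred : reducedCircuits A X = ∅ :=
      Set.subset_empty_iff.1 (h ▸ fun l hl => hl.1)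
    exact nonneg_on_sageCone hA hX hXconvex hlin (ContinuousLinearMap.proj γ)
      (fun d hd => hd γ) (by simp [hred]) hc
  · obtain ⟨β, hβ⟩ := hA
    exact mem_sageCone_of_mem_ageCone (β := ⟨β, hβ⟩)
      ⟨fun x _ => sum_nonneg fun α _ => mul_nonneg (hc α) (Real.exp_pos _).le, fun α _ => hc α⟩

theorem sageCone_eq_closure (hA : A.Nonempty) (hX : X.Nonempty) (hXconvex : Convex ℝ X)
    (hlin : LinearIndependent ℝ
      (fun (α : A) (x : X) => Real.exp (inner ℝ (α : E n) (x : E n))))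
    (h : (normalizedCircuits A X).Nonempty) :
    sageCone A X =
      closure (convexHull ℝ (⋃ l ∈ reducedCircuits A X, witnessedCone A X l)) := by
  refine Set.Subset.antisymm (fun c hc => ?_) ?_
  · by_contra hnot
    obtain ⟨f, s, hfc, hfs⟩ := geometric_hahn_banach_point_closed
      (convex_convexHull ℝ _).closure isClosed_closure hnot
    have hmem : ∀ l ∈ reducedCircuits A X, ∀ d ∈ witnessedCone A X l, s < f d :=
      fun l hl d hd => hfs d (subset_closure (subset_convexHull ℝ _ (Set.mem_biUnion hl hd)))
    have hfw : ∀ l ∈ reducedCircuits A X, ∀ d ∈ witnessedCone A X l, 0 ≤ f d := by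
      intro l hl d hd
      by_contra! hneg
      -- A functional bounded below on a cone cannot be negative on it.
      have ht : 0 < (|s| + 1) / (-f d) := div_pos (by positivity) (by linarith)
      have h1 := hmem l hl _ (smul_mem_witnessedCone hd ht)
      rw [map_smul, smul_eq_mul, div_neg, neg_mul, div_mul_cancel₀ _ hneg.ne] at h1
      linarith [neg_abs_le s]
    obtain ⟨l₀, hl₀⟩ := reducedCircuits_nonempty hA hX hlin h
    obtain ⟨β, hcirc, hβ⟩ := hl₀.1
    have horth : ∀ d : A → ℝ, (∀ α, 0 ≤ d α) → d ∈ witnessedCone A X l₀ :=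
      fun d hd => mem_witnessedCone_of_nonneg hcirc.1 hβ hd
    have h0 := hmem l₀ hl₀ 0 (horth 0 fun _ => le_rfl)
    rw [map_zero] at h0
    have := nonneg_on_sageCone hA hX hXconvex hlin f
      (fun d hd => hfw l₀ hl₀ d (horth d hd)) hfw hc
    linarith
  · refine closure_minimal (convexHull_min ?_ ?_) (isClosed_sageCone hX hlin)
    · refine Set.iUnion₂_subset fun l hl c hc => ?_
      obtain ⟨β, hcirc, -⟩ := hl.1
      obtain ⟨β', hage⟩ := witnessedCone_subset_ageCone hX hcirc.2.2.1 hc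
      exact mem_sageCone_of_mem_ageCone hage
    · rw [sageCone_eq_iSup]
      exact PointedCone.convex _

end SublinearCircuits

end

theorem theorem5p3 (n : ℕ) (A : Finset (EuclideanSpace ℝ (Fin n)))
    (X : Set (EuclideanSpace ℝ (Fin n)))
    (hA : A.Nonempty) (hXne : X.Nonempty) (hXclosed : IsClosed X) (hXconvex : Convex ℝ X)
    (hlin : LinearIndependent ℝ
      (fun (α : A) (x : X) => Real.exp
        (inner ℝ (α : EuclideanSpace ℝ (Fin n)) (x : EuclideanSpace ℝ (Fin n))))) :
    (SublinearCircuits.normalizedCircuits A X = ∅ →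
      SublinearCircuits.sageCone A X = {c | ∀ α, 0 ≤ c α}) ∧
    ((SublinearCircuits.normalizedCircuits A X).Nonempty →
      SublinearCircuits.sageCone A X =
        closure (convexHull ℝ (⋃ l ∈ SublinearCircuits.reducedCircuits A X,
          SublinearCircuits.witnessedCone A X l))) := by
  exact ⟨SublinearCircuits.sageCone_eq_nonneg hA hXne hXconvex hlin,
    SublinearCircuits.sageCone_eq_closure hA hXne hXconvex hlin⟩
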